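/- Let $\gamma_\star>0$ and $\alpha\in[1/2,1]$, with $\gamma_\star<1$ if $\alpha=1/2$, and put $\gamma_n=\gamma_\star n^{-\alpha}$ for $n\ge 1$. For $\varepsilon\in(0,1)$ let $\theta_\star(1)=\theta_\star(3)=\frac{1}{2+\varepsilon}$ and $\theta_\star(2)=\frac{\varepsilon}{2+\varepsilon}$. For a vector $\theta=(\theta(1),\theta(2),\theta(3))$ of positive weights with sum $1$ let $\pi_\theta$ be the probability on $\{1,2,3\}$ with $$\pi_\theta(i)=\Big(\sum_{j=1}^3\frac{\theta_\star(j)}{\theta(j)}\Big)^{-1}\frac{\theta_\star(i)}{\theta(i)},$$ and let $P_\theta$ be the Metropolis kernel with target $\pi_\theta$ and proposal matrix $$Q=\begin{pmatrix}2/3&1/3&0\\1/3&1/3&1/3\\0&1/3&2/3\end{pmatrix},$$ that is, $P_\theta(i,j)=Q(i,j)\,\big(1\wedge\frac{\pi_\theta(j)}{\pi_\theta(i)}\big)$ for $i\ne j$, and $P_\theta(i,i)=1-\sum_{j\neq i}P_\theta(i,j)$. The Wang--Landau process $(X_n,\theta_n)_{n\ge0}$ starts from $X_0=1$ and $\theta_0=(1/3,1/3,1/3)$.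 Given the past up to time $n$, the state $X_{n+1}$ is drawn from $P_{\theta_n}(X_n,\cdot)$, and then the weights are updated by $$\theta_{n+1}(i)=\theta_n(i)\,\frac{1+\gamma_{n+1}\mathbf 1_{\{X_{n+1}=i\}}}{1+\gamma_{n+1}\theta_n(X_{n+1})},\qquad i=1,2,3.$$ Let $T_{1\to3}=\min\{n: X_n=3\}$, with $T_{1\to3}=\infty$ if state $3$ is never visited. Everything except $\gamma_\star$ and $\alpha$ depends on $\varepsilon$. 1. If $\alpha\in[1/2,1)$, then $|\ln\varepsilon|^{-1/(1-\alpha)}\,T_{1\to3}$ converges in probability to $\left(\frac{1-\alpha}{\gamma_\star}\right)^{1/(1-\alpha)}$ as $\varepsilon\to0$. 2. If $\alpha=1$, then for every function $h$ with $\lim_{\varepsilon\to0}h(\varepsilon)=+\infty$, $$\lim_{\varepsilon\to0}\mathbb P\Big(\frac1{h(\varepsilon)}<\varepsilon^{1/(1+\gamma_\star)}\,T_{1\to3}<h(\varepsilon)\Big)=1.$$ -/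

import Mathlib

open MeasureTheory ProbabilityTheory Filter Topology

/-! The three-state Wang-Landau dynamics. The states (= strata) `1, 2, 3` are the elements
`0, 1, 2` of `Fin 3`, in this order. -/

namespace WangLandau

/-- The equilibrium weights `θ⋆ = (1, ε, 1) / (2 + ε)`. -/
noncomputable def thetaStar (ε : ℝ) : Fin 3 → ℝ :=
  ![1 / (2 + ε), ε / (2 + ε), 1 / (2 + ε)]

/-- The biased probability `π_θ(i) = (∑ j, θ⋆(j) / θ(j))⁻¹ θ⋆(i) / θ(i)`. -/
noncomputable def biased (ε : ℝ) (θ : Fin 3 → ℝ) (i : Fin 3) : ℝ :=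
  (∑ j, thetaStar ε j / θ j)⁻¹ * (thetaStar ε i / θ i)

/-- The symmetric nearest-neighbour proposal kernel. -/
noncomputable def proposal : Matrix (Fin 3) (Fin 3) ℝ :=
  !![2 / 3, 1 / 3, 0;
     1 / 3, 1 / 3, 1 / 3;
     0, 1 / 3, 2 / 3]

/-- The Metropolis kernel with symmetric proposal `Q` and target `π`: off the diagonal,
`P i j = Q i j (1 ∧ π j / π i)`; the diagonal makes every row sum to one. -/
noncomputable def metropolis (Q : Matrix (Fin 3) (Fin 3) ℝ) (π : Fin 3 → ℝ) :
    Matrix (Fin 3) (Fin 3) ℝ :=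
  fun i j =>
    if i = j then 1 - ∑ k ∈ Finset.univ.erase i, Q i k * min 1 (π k / π i)
    else Q i j * min 1 (π j / π i)

/-- The transition matrix `P_θ` of the Wang-Landau dynamics. -/
noncomputable def kernel (ε : ℝ) (θ : Fin 3 → ℝ) : Matrix (Fin 3) (Fin 3) ℝ :=
  metropolis proposal (biased ε θ)

/-- The update of the weights `θ` after a visit of the state `x`, with step size `g`. -/
noncomputable def update (g : ℝ) (θ : Fin 3 → ℝ) (x : Fin 3) : Fin 3 → ℝ :=
  fun i => θ i * (1 + g * if x = i then 1 else 0) / (1 + g * θ x)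

/-- The step sizes `γ_n = γ⋆ n^(-α)`, used for `n ≥ 1` only. -/
noncomputable def stepSize (γs α : ℝ) (n : ℕ) : ℝ := γs * (n : ℝ) ^ (-α)

/-- `(X, θ)` is a Wang-Landau process with parameter `ε` and step sizes `γ`, relative to the
filtration `ℱ` and under the probability measure `P`, started from the state `1` (`0 : Fin 3`)
with equal weights: given the past up to time `n`, the next state `X (n + 1)` is drawn from
`P_{θ n} (X n, ·)`, and then the weights are updated. -/
structure IsProcess {Ω : Type*} [mΩ : MeasurableSpace Ω] (ε : ℝ) (γ : ℕ → ℝ) (P : Measure Ω)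
    (ℱ : Filtration ℕ mΩ) (X : ℕ → Ω → Fin 3) (θ : ℕ → Ω → Fin 3 → ℝ) : Prop where
  adapted_state : ∀ n, Measurable[ℱ n] (X n)
  adapted_weight : ∀ n, Measurable[ℱ n] (θ n)
  state_zero : ∀ᵐ ω ∂P, X 0 ω = 0
  weight_zero : ∀ ω i, θ 0 ω i = 1 / 3
  transition : ∀ n j,
    P⟦X (n + 1) ⁻¹' {j} | ℱ n⟧ =ᵐ[P] fun ω => kernel ε (θ n ω) (X n ω) j
  weight_succ : ∀ n ω, θ (n + 1) ω = update (γ (n + 1)) (θ n ω) (X (n + 1) ω)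

/-- The exit time `T_{1 → 3} = min {n | X n = 3}`, equal to `⊤` if the state `3`
(`2 : Fin 3`) is never visited. -/
noncomputable def exitTime {Ω : Type*} (X : ℕ → Ω → Fin 3) (ω : Ω) : ℕ∞ :=
  hittingAfter X {2} 0 ω

end WangLandau

namespace WangLandau

/-! States are written `0`, `1`, `2`. While `2` is unvisited, `θ 2 ≤ θ 1`, so each visit to `1` is
followed by a jump to `2` with probability `1/3`. Hence the expected number of visits to `1` before
the exit is at most `3`, and the exit is governed by the rare jumps from `0` to `1`, of probability
`1/3 * min 1 (ε * θ 0 / θ 1)`. The ratio `θ 0 / θ 1` is at most `growth γ k` and, up to a factor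
exponential in the number of visits to `1`, at least that large. So the exit occurs when `ε * ∑
growth γ k` becomes of order one.

A union bound over these jumps gives the lower bound on the exit time
(`measureReal_compl_survival_le`). For the upper bound, the accumulated jump rate on survival is
bounded by the expected number of visits to `1`, outside an event of many visits that Markov's
inequality controls (`measureReal_survival_mul_le`).

What remains is analysis. For `α < 1`, `log (growth n) ~ γs / (1 - α) * n ^ (1 - α)`, and polynomial
factors in `n` do not affect the scale. For `α = 1`, `growth n` is comparable to `n ^ γs`, so the
balance is `ε * n ^ (1 + γs) ≍ 1`. -/

/-- The product `∏_{1 ≤ j ≤ k} (1 + γ j)`, by which a weight grows over `k` consecutive visits. -/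
noncomputable def growth (γ : ℕ → ℝ) (k : ℕ) : ℝ := ∏ j ∈ Finset.range k, (1 + γ (j + 1))

lemma growth_succ (γ : ℕ → ℝ) (k : ℕ) : growth γ (k + 1) = growth γ k * (1 + γ (k + 1)) :=
  Finset.prod_range_succ _ _

lemma growth_pos {γ : ℕ → ℝ} (hγ : ∀ n, 0 ≤ γ n) (k : ℕ) : 0 < growth γ k :=
  Finset.prod_pos fun j _ => by linarith [hγ (j + 1)]

lemma growth_mono {γ : ℕ → ℝ} (hγ : ∀ n, 0 ≤ γ n) : Monotone (growth γ) :=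
  monotone_nat_of_le_succ fun k => by
    rw [growth_succ]
    nlinarith [hγ (k + 1), growth_pos hγ k]

/-! ### Transition probabilities that govern the exit. -/

section Kernel

variable {ε : ℝ} {θ : Fin 3 → ℝ}

lemma biased_div_biased (hε : 0 < ε) (hθ : ∀ i, 0 < θ i) (i j : Fin 3) :
    biased ε θ j / biased ε θ i = (thetaStar ε j / θ j) / (thetaStar ε i / θ i) := by
  have hpos : ∀ k, 0 < thetaStar ε k / θ k := fun k => by
    refine div_pos ?_ (hθ k)
    fin_cases k <;> simp [thetaStar] <;> positivity
  have : (∑ k, thetaStar ε k / θ k)⁻¹ ≠ 0 :=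
    inv_ne_zero (Finset.sum_pos (fun k _ => hpos k) Finset.univ_nonempty).ne'
  exact mul_div_mul_left _ _ this

lemma kernel_zero_one (hε : 0 < ε) (hθ : ∀ i, 0 < θ i) :
    kernel ε θ 0 1 = 1 / 3 * min 1 (ε * θ 0 / θ 1) := by
  have h0 := (hθ 0).ne'
  have h1 := (hθ 1).ne'
  have : biased ε θ 1 / biased ε θ 0 = ε * θ 0 / θ 1 := by
    rw [biased_div_biased hε hθ]
    simp only [thetaStar, Matrix.cons_val_zero, Matrix.cons_val_one]
    field_simp
  simp [kernel, metropolis, proposal, this]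

lemma kernel_zero_two : kernel ε θ 0 2 = 0 := by
  simp [kernel, metropolis, proposal]

/-- The acceptance ratio `θ 1 / (ε * θ 2)` is at least one, so the proposal is always accepted. -/
lemma kernel_one_two (hε : 0 < ε) (hε1 : ε ≤ 1) (hθ : ∀ i, 0 < θ i) (h : θ 2 ≤ θ 1) :
    kernel ε θ 1 2 = 1 / 3 := by
  have h2 := hθ 2
  have h1 := hθ 1
  have : biased ε θ 2 / biased ε θ 1 = θ 1 / (ε * θ 2) := by
    rw [biased_div_biased hε hθ]
    simp only [thetaStar, Matrix.cons_val_one, Matrix.cons_val]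
    field_simp
  have hle : (1 : ℝ) ≤ θ 1 / (ε * θ 2) := by
    rw [le_div_iff₀ (by positivity)]
    nlinarith
  simp [kernel, metropolis, proposal, this, min_eq_left hle]

end Kernel

/-! ### Comparison of the weights along a fixed trajectory. -/

section Weights

variable {γ : ℕ → ℝ} {x : ℕ → Fin 3} {w : ℕ → Fin 3 → ℝ}

lemma weight_pos (hγ : ∀ n, 0 ≤ γ n) (h0 : ∀ i, w 0 i = 1 / 3)
    (hw : ∀ n, w (n + 1) = update (γ (n + 1)) (w n) (x (n + 1))) (n : ℕ) (i : Fin 3) :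
    0 < w n i := by
  induction n generalizing i with
  | zero => simp [h0]
  | succ n ih =>
    have := hγ (n + 1)
    have := ih i
    have := ih (x (n + 1))
    rw [hw, update]
    split_ifs <;> positivity

/-- The number of visits of the state `1` up to time `k`. -/
def visits (x : ℕ → Fin 3) (k : ℕ) : ℕ := ((Finset.range (k + 1)).filter fun j => x j = 1).card

lemma visits_succ (x : ℕ → Fin 3) (k : ℕ) :
    visits x (k + 1) = visits x k + if x (k + 1) = 1 then 1 else 0 := by
  unfold visits
  rw [Finset.range_add_one (n := k + 1), Finset.filter_insert]
  split_ifs <;> simp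

lemma weight_two_le_weight_one (hγ : ∀ n, 0 ≤ γ n) (h0 : ∀ i, w 0 i = 1 / 3)
    (hw : ∀ n, w (n + 1) = update (γ (n + 1)) (w n) (x (n + 1))) (n : ℕ)
    (hx : ∀ j ≤ n, x j ≠ 2) : w n 2 ≤ w n 1 := by
  induction n with
  | zero => simp [h0]
  | succ n ih =>
    have h1 := weight_pos hγ h0 hw n 1
    have hg := hγ (n + 1)
    have h3 := weight_pos hγ h0 hw n (x (n + 1))
    have ih := ih fun j hj => hx j (by omega)
    rw [hw]
    simp only [update, if_neg (hx (n + 1) le_rfl)]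
    gcongr
    split_ifs <;> simp

/-- The normalisation cancels in `w 0 / w 1`, so one step multiplies this ratio by at most `1 + γ`.
-/
lemma weight_zero_le_growth_mul (hγ : ∀ n, 0 ≤ γ n) (h0 : ∀ i, w 0 i = 1 / 3)
    (hw : ∀ n, w (n + 1) = update (γ (n + 1)) (w n) (x (n + 1))) (n : ℕ) :
    w n 0 ≤ growth γ n * w n 1 := by
  induction n with
  | zero => simp [h0, growth]
  | succ n ih =>
    have h1 := weight_pos hγ h0 hw n 1
    have h2 := weight_pos hγ h0 hw n 0
    have hg := hγ (n + 1)
    have hG := growth_pos hγ n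
    have h3 := weight_pos hγ h0 hw n (x (n + 1))
    rw [hw, growth_succ]
    simp only [update]
    rw [← mul_div_assoc]
    gcongr ?_ / _
    calc w n 0 * (1 + γ (n + 1) * if x (n + 1) = 0 then 1 else 0)
        ≤ (growth γ n * w n 1) * (1 + γ (n + 1) * 1) := by
          gcongr
          split_ifs <;> simp
      _ ≤ (growth γ n * (1 + γ (n + 1))) *
            (w n 1 * (1 + γ (n + 1) * if x (n + 1) = 1 then 1 else 0)) := by
          have : (1 : ℝ) ≤ 1 + γ (n + 1) * if x (n + 1) = 1 then 1 else 0 := by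
            split_ifs <;> simp [hg]
          have hp : 0 ≤ growth γ n * w n 1 * (1 + γ (n + 1)) := by positivity
          nlinarith [mul_le_mul_of_nonneg_left this hp]

/-- Each visit to `1` costs two factors `1 + γ ≤ 1 + g`: `w 0` misses one that `growth` contains,
and `w 1` gains one. Visits to `0` cost nothing. -/
lemma growth_mul_weight_one_le {g : ℝ} (hγ : ∀ n, 0 ≤ γ n) (hg : ∀ n, γ n ≤ g)
    (h0 : ∀ i, w 0 i = 1 / 3)
    (hw : ∀ n, w (n + 1) = update (γ (n + 1)) (w n) (x (n + 1))) (n : ℕ)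
    (hx : ∀ j ≤ n, x j ≠ 2) :
    growth γ n * w n 1 ≤ w n 0 * (1 + g) ^ (2 * visits x n) := by
  have hg0 : 0 ≤ g := (hγ 0).trans (hg 0)
  induction n with
  | zero => simpa [h0, growth] using one_le_pow₀ (by linarith : (1 : ℝ) ≤ 1 + g)
  | succ n ih =>
    have ih := ih fun j hj => hx j (by omega)
    have h1 := weight_pos hγ h0 hw n 1
    have h2 := weight_pos hγ h0 hw n 0
    have hn := hγ (n + 1)
    have hgn := hg (n + 1)
    have hG := growth_pos hγ n
    have h3 := weight_pos hγ h0 hw n (x (n + 1))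
    rw [hw, growth_succ, visits_succ]
    simp only [update]
    rw [← mul_div_assoc, div_mul_eq_mul_div]
    gcongr ?_ / _
    have hx' := hx (n + 1) le_rfl
    have hcases : x (n + 1) = 0 ∨ x (n + 1) = 1 := by
      generalize x (n + 1) = y at hx'
      fin_cases y <;> simp_all
    rcases hcases with h | h
    · simp only [h, zero_ne_one, if_false, if_true, mul_zero, mul_one, add_zero]
      nlinarith
    · simp only [h, one_ne_zero, if_false, if_true, mul_zero, mul_one, add_zero]
      calc growth γ n * (1 + γ (n + 1)) * (w n 1 * (1 + γ (n + 1)))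
          = growth γ n * w n 1 * (1 + γ (n + 1)) ^ 2 := by ring
        _ ≤ (w n 0 * (1 + g) ^ (2 * visits x n)) * (1 + g) ^ 2 := by gcongr
        _ = _ := by ring

end Weights

/-! ### Probability estimates for a fixed `ε`. -/

section Dynamics

variable {Ω : Type*} {X : ℕ → Ω → Fin 3}

/-- The event that the state `2` is not visited up to time `k`. -/
def survival (X : ℕ → Ω → Fin 3) (k : ℕ) : Set Ω := {ω | ∀ j ≤ k, X j ω ≠ 2}

lemma survival_anti (X : ℕ → Ω → Fin 3) : Antitone (survival X) :=
  fun _ _ hkl _ h j hj => h j (hj.trans hkl)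

lemma mem_survival_iff {N : ℕ} {ω : Ω} : ω ∈ survival X N ↔ (N : ℕ∞) < exitTime X ω := by
  have := hittingAfter_le_iff (u := X) (s := {2}) (n := 0) (i := N) (ω := ω)
  rw [← not_le]
  refine Iff.trans ?_ (not_congr this).symm
  simp [survival]

namespace IsProcess

variable [mΩ : MeasurableSpace Ω] {ε : ℝ} {γ : ℕ → ℝ} {P : Measure Ω} {ℱ : Filtration ℕ mΩ}
  {θ : ℕ → Ω → Fin 3 → ℝ}

lemma weight_pos (h : IsProcess ε γ P ℱ X θ) (hγ : ∀ n, 0 ≤ γ n) (n : ℕ) (ω : Ω) (i : Fin 3) :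
    0 < θ n ω i :=
  WangLandau.weight_pos (w := fun n => θ n ω) (x := fun n => X n ω) hγ (h.weight_zero ω)
    (fun n => h.weight_succ n ω) n i

lemma measurableSet_preimage (h : IsProcess ε γ P ℱ X θ) {j k : ℕ} (hjk : j ≤ k) (i : Fin 3) :
    MeasurableSet[ℱ k] {ω | X j ω = i} :=
  ℱ.mono hjk _ (h.adapted_state j (measurableSet_singleton i))

lemma measurableSet_survival (h : IsProcess ε γ P ℱ X θ) (k : ℕ) :
    MeasurableSet[ℱ k] (survival X k) := by
  have : survival X k = ⋂ j : Fin (k + 1), {ω | X j ω = 2}ᶜ := by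
    ext ω
    simp only [survival, Set.mem_ofPred_eq, Set.mem_iInter, Set.mem_compl_iff]
    exact ⟨fun H j => H j (by omega), fun H j hj => H ⟨j, by omega⟩⟩
  rw [this]
  exact MeasurableSet.iInter fun j => (h.measurableSet_preimage (by omega) 2).compl

lemma measurable_visits (h : IsProcess ε γ P ℱ X θ) (k : ℕ) :
    Measurable[ℱ k] fun ω => visits (fun j => X j ω) k := by
  have : (fun ω => visits (fun j => X j ω) k) =
      fun ω => ∑ j ∈ Finset.range (k + 1), if X j ω = 1 then 1 else 0 := by
    ext ω
    simp [visits]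
  rw [this]
  refine Finset.measurable_sum _ fun j hj => ?_
  exact Measurable.ite (h.measurableSet_preimage (by simp at hj; omega) 1) measurable_const
    measurable_const

variable [IsProbabilityMeasure P]

/-- Integrability is inherited from the conditional expectation, which avoids any discussion of the
measurability of `kernel` in `θ`. -/
lemma measureReal_inter_transition (h : IsProcess ε γ P ℱ X θ) (n : ℕ) (j : Fin 3) {E : Set Ω}
    (hE : MeasurableSet[ℱ n] E) :
    Integrable (fun ω => kernel ε (θ n ω) (X n ω) j) P ∧
      P.real (E ∩ {ω | X (n + 1) ω = j}) = ∫ ω in E, kernel ε (θ n ω) (X n ω) j ∂P := by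
  have hm : MeasurableSet {ω | X (n + 1) ω = j} :=
    ℱ.le _ _ (h.measurableSet_preimage le_rfl j)
  refine ⟨integrable_condExp.congr (h.transition n j), ?_⟩
  have hc := setIntegral_condExp (μ := P) (ℱ.le n) ((integrable_const (1 : ℝ)).indicator hm) hE
  rw [← setIntegral_congr_ae (ℱ.le n _ hE) ((h.transition n j).mono fun ω hω _ => hω)]
  refine Eq.trans ?_ hc.symm
  change _ = ∫ ω in E, ({ω | X (n + 1) ω = j}).indicator (fun _ => (1 : ℝ)) ω ∂P
  rw [setIntegral_indicator hm]
  simp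

lemma mul_le_measureReal_inter (h : IsProcess ε γ P ℱ X θ) (n : ℕ) (j : Fin 3) {E : Set Ω}
    (hE : MeasurableSet[ℱ n] E) {c : ℝ} (hc : ∀ ω ∈ E, c ≤ kernel ε (θ n ω) (X n ω) j) :
    c * P.real E ≤ P.real (E ∩ {ω | X (n + 1) ω = j}) := by
  obtain ⟨hi, he⟩ := h.measureReal_inter_transition n j hE
  rw [he]
  have := setIntegral_mono_on (integrable_const c).integrableOn hi.integrableOn (ℱ.le n _ hE) hc
  simpa [mul_comm] using this

lemma measureReal_inter_le_mul (h : IsProcess ε γ P ℱ X θ) (n : ℕ) (j : Fin 3) {E : Set Ω}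
    (hE : MeasurableSet[ℱ n] E) {c : ℝ} (hc : ∀ ω ∈ E, kernel ε (θ n ω) (X n ω) j ≤ c) :
    P.real (E ∩ {ω | X (n + 1) ω = j}) ≤ c * P.real E := by
  obtain ⟨hi, he⟩ := h.measureReal_inter_transition n j hE
  rw [he]
  have := setIntegral_mono_on hi.integrableOn (integrable_const c).integrableOn (ℱ.le n _ hE) hc
  simpa [mul_comm] using this

/-- The state `2` is rarely reached before the growth of the first weight exceeds `1 / ε`. -/
lemma measureReal_compl_survival_le (h : IsProcess ε γ P ℱ X θ) (hε : 0 < ε)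
    (hγ : ∀ n, 0 ≤ γ n) (N : ℕ) :
    P.real (survival X N)ᶜ ≤ ε * ∑ k ∈ Finset.range N, growth γ k := by
  set E : ℕ → Set Ω := fun k => {ω | X k ω = 0}
  have hE : ∀ k, MeasurableSet[ℱ k] (E k) := fun k => h.measurableSet_preimage le_rfl 0
  -- A path that starts at `0` and never jumps from `0` to `1` or `2` stays at `0`.
  have hsub : (survival X N)ᶜ ⊆ {ω | X 0 ω ≠ 0} ∪ ⋃ k ∈ Finset.range N,
      (E k ∩ {ω | X (k + 1) ω = 1} ∪ E k ∩ {ω | X (k + 1) ω = 2}) := by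
    intro ω hω
    by_contra hcon
    simp only [Set.mem_union, Set.mem_iUnion, not_or, not_exists, Set.mem_inter_iff, E,
      Set.mem_ofPred_eq, not_and, not_not, Finset.mem_range] at hcon
    have hall : ∀ k ≤ N, X k ω = 0 := by
      intro k
      induction k with
      | zero => exact fun _ => hcon.1
      | succ k ih =>
        intro hk
        have h0 := hcon.2 k (by omega)
        have h1 := h0.1 (ih (by omega))
        have h2 := h0.2 (ih (by omega))
        generalize X (k + 1) ω = y at h1 h2
        fin_cases y <;> simp_all
    exact hω fun j hj => by simp [hall j hj]
  have h0 : P.real {ω | X 0 ω ≠ 0} = 0 := by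
    rw [measureReal_def, show P {ω | X 0 ω ≠ 0} = 0 from h.state_zero, ENNReal.toReal_zero]
  have hone : ∀ k, P.real (E k ∩ {ω | X (k + 1) ω = 1}) ≤ ε * growth γ k := by
    intro k
    have hG := growth_pos hγ k
    refine (h.measureReal_inter_le_mul k 1 (hE k) (c := ε * growth γ k) ?_).trans
      (mul_le_of_le_one_right (by positivity) measureReal_le_one)
    intro ω hω
    have hp := h.weight_pos hγ k ω
    have hω' : X k ω = 0 := hω
    rw [hω', kernel_zero_one hε hp]
    have hle := weight_zero_le_growth_mul (w := fun n => θ n ω) (x := fun n => X n ω) hγ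
      (h.weight_zero ω) (fun n => h.weight_succ n ω) k
    have : ε * θ k ω 0 / θ k ω 1 ≤ ε * growth γ k := by
      rw [div_le_iff₀ (hp 1), mul_assoc]
      gcongr
    have h3 := (min_le_right 1 _).trans this
    nlinarith [mul_pos hε hG]
  have htwo : ∀ k, P.real (E k ∩ {ω | X (k + 1) ω = 2}) ≤ 0 := by
    intro k
    refine (h.measureReal_inter_le_mul k 2 (hE k) (c := 0) ?_).trans (by simp)
    intro ω hω
    have hω' : X k ω = 0 := hω
    rw [hω', kernel_zero_two]
  calc P.real (survival X N)ᶜ ≤ _ := measureReal_mono hsub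
    _ ≤ P.real {ω | X 0 ω ≠ 0} + P.real _ := measureReal_union_le _ _
    _ ≤ 0 + ∑ k ∈ Finset.range N,
          P.real (E k ∩ {ω | X (k + 1) ω = 1} ∪ E k ∩ {ω | X (k + 1) ω = 2}) := by
        gcongr
        · exact h0.le
        · exact measureReal_biUnion_finset_le _ _
    _ ≤ 0 + ∑ k ∈ Finset.range N, ε * growth γ k := by
        gcongr with k
        refine (measureReal_union_le _ _).trans ?_
        linarith [hone k, htwo k]
    _ = _ := by rw [zero_add, Finset.mul_sum]

/-- The expected number of visits of the state `1` before the exit time is at most `3`. -/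
lemma sum_measureReal_survival_inter_le (h : IsProcess ε γ P ℱ X θ) (hε : 0 < ε) (hε1 : ε ≤ 1)
    (hγ : ∀ n, 0 ≤ γ n) (N : ℕ) :
    ∑ k ∈ Finset.range N, P.real (survival X k ∩ {ω | X k ω = 1}) ≤ 3 := by
  -- A third of the mass at `1` is lost from survival at the next step, and the losses telescope.
  have key : ∀ k, P.real (survival X k ∩ {ω | X k ω = 1}) ≤
      3 * (P.real (survival X k) - P.real (survival X (k + 1))) := by
    intro k
    have hE := (h.measurableSet_survival k).inter (h.measurableSet_preimage (le_refl k) 1)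
    have h1 := h.mul_le_measureReal_inter k 2 hE (c := 1 / 3) fun ω hω => by
      have hω' : X k ω = 1 := hω.2
      rw [hω', kernel_one_two hε hε1 (h.weight_pos hγ k ω)]
      exact weight_two_le_weight_one (w := fun n => θ n ω) (x := fun n => X n ω) hγ
        (h.weight_zero ω) (fun n => h.weight_succ n ω) k hω.1
    have h2 : P.real (survival X k ∩ {ω | X k ω = 1} ∩ {ω | X (k + 1) ω = 2}) ≤
        P.real (survival X k \ survival X (k + 1)) :=
      measureReal_mono fun ω hω => ⟨hω.1.1, fun hcon => hcon (k + 1) le_rfl hω.2⟩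
    rw [measureReal_sdiff (survival_anti X k.le_succ)
      (ℱ.le _ _ (h.measurableSet_survival (k + 1)))] at h2
    linarith
  calc _ ≤ ∑ k ∈ Finset.range N, 3 * (P.real (survival X k) - P.real (survival X (k + 1))) :=
        Finset.sum_le_sum fun k _ => key k
    _ = 3 * (P.real (survival X 0) - P.real (survival X N)) := by
        rw [← Finset.mul_sum, Finset.sum_range_sub']
    _ ≤ 3 := by
        have : P.real (survival X 0) ≤ 1 := measureReal_le_one
        have : 0 ≤ P.real (survival X N) := measureReal_nonneg
        linarith

/-- Markov's inequality for the number of visits to `1` before the exit, whose mean is at most `3`.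
On `survival X k` this number up to time `k` is `visits`. -/
lemma measureReal_le_visits_le (h : IsProcess ε γ P ℱ X θ) (hε : 0 < ε) (hε1 : ε ≤ 1)
    (hγ : ∀ n, 0 ≤ γ n) (M k : ℕ) :
    M * P.real (survival X k ∩ {ω | M ≤ visits (fun j => X j ω) k}) ≤ 3 := by
  set B : ℕ → Set Ω := fun j => survival X j ∩ {ω | X j ω = 1}
  have hB : ∀ j, MeasurableSet (B j) := fun j =>
    ℱ.le _ _ ((h.measurableSet_survival j).inter (h.measurableSet_preimage (le_refl j) 1))
  have hint : ∀ j, Integrable ((B j).indicator fun _ => (1 : ℝ)) P := fun j =>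
    (integrable_const _).indicator (hB j)
  set f : Ω → ℝ := fun ω => ∑ j ∈ Finset.range (k + 1), (B j).indicator (fun _ => (1 : ℝ)) ω
  have hf : ∫ ω, f ω ∂P ≤ 3 := by
    rw [integral_finsetSum _ fun j _ => hint j]
    simp only [integral_indicator_const _ (hB _), smul_eq_mul, mul_one]
    exact h.sum_measureReal_survival_inter_le hε hε1 hγ _
  have hmarkov := mul_meas_ge_le_integral_of_nonneg (μ := P) (f := f)
    (ae_of_all _ fun ω => Finset.sum_nonneg fun j _ =>
      Set.indicator_nonneg (fun _ _ => zero_le_one) _)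
    (integrable_finsetSum _ fun j _ => hint j) (M : ℝ)
  refine le_trans ?_ (hmarkov.trans hf)
  refine mul_le_mul_of_nonneg_left ?_ (Nat.cast_nonneg M)
  refine measureReal_mono (fun ω hω => ?_) (measure_ne_top P _)
  change (M : ℝ) ≤ f ω
  have hfω : f ω = visits (fun j => X j ω) k := by
    simp only [f, visits, Finset.card_filter, Nat.cast_sum]
    refine Finset.sum_congr rfl fun j hj => ?_
    have hs : ω ∈ survival X j := survival_anti X (by simp at hj; omega) hω.1
    by_cases hj1 : X j ω = 1
    · simp [B, hs, hj1]
    · simp [B, hj1]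
  rw [hfω]
  exact_mod_cast hω.2

/-- The state `2` is reached before the time at which the accumulated rate of jumps from `0` to
`1` is large. -/
lemma measureReal_survival_mul_le {g : ℝ} (h : IsProcess ε γ P ℱ X θ) (hε : 0 < ε) (hε1 : ε ≤ 1)
    (hγ : ∀ n, 0 ≤ γ n) (hg : ∀ n, γ n ≤ g) {M : ℕ} (hM : 0 < M) (N : ℕ) {Q : ℝ}
    (hQ : Q = ∑ k ∈ Finset.range N, 1 / 3 * min 1 (ε * growth γ k / (1 + g) ^ (2 * M))) :
    P.real (survival X N) * Q ≤ 4 + 3 / M * Q := by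
  have hg0 : 0 ≤ g := (hγ 0).trans (hg 0)
  set q : ℕ → ℝ := fun k => 1 / 3 * min 1 (ε * growth γ k / (1 + g) ^ (2 * M)) with hq
  have hq0 : ∀ k, 0 ≤ q k := fun k => by
    have := growth_pos hγ k
    positivity
  have hq1 : ∀ k, q k ≤ 1 / 3 := fun k => by
    have := min_le_left 1 (ε * growth γ k / (1 + g) ^ (2 * M))
    simp only [hq]
    linarith
  set D : ℕ → Set Ω := fun k => survival X k ∩ {ω | X k ω = 1}
  set E : ℕ → Set Ω := fun k =>
    survival X k ∩ {ω | X k ω = 0} ∩ {ω | visits (fun j => X j ω) k < M}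
  set F : ℕ → Set Ω := fun k => survival X k ∩ {ω | M ≤ visits (fun j => X j ω) k}
  have hE : ∀ k, MeasurableSet[ℱ k] (E k) := fun k =>
    ((h.measurableSet_survival k).inter (h.measurableSet_preimage (le_refl k) 0)).inter
      (h.measurable_visits k measurableSet_Iio)
  -- A surviving path is at `1`, or at `0` with fewer than `M` visits to `1`, or has made at least
  -- `M` such visits. Only in the second case is the jump rate bounded below by `q k`.
  have hcover : ∀ k ≤ N, P.real (survival X N) ≤ P.real (E k) + P.real (D k) + P.real (F k) := by
    intro k hk
    have hsub : survival X N ⊆ E k ∪ D k ∪ F k := by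
      intro ω hω
      have hs := survival_anti X hk hω
      have hX := hs k le_rfl
      have hcases : X k ω = 0 ∨ X k ω = 1 := by
        generalize X k ω = y at hX
        fin_cases y <;> simp_all
      rcases hcases with h0 | h1
      · rcases lt_or_ge (visits (fun j => X j ω) k) M with hv | hv
        · exact Or.inl (Or.inl ⟨⟨hs, h0⟩, hv⟩)
        · exact Or.inr ⟨hs, hv⟩
      · exact Or.inl (Or.inr ⟨hs, h1⟩)
    refine (measureReal_mono hsub).trans ((measureReal_union_le _ _).trans ?_)
    gcongr
    exact measureReal_union_le _ _
  have hjump : ∀ k, q k * P.real (E k) ≤ P.real (D (k + 1)) := by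
    intro k
    refine (h.mul_le_measureReal_inter k 1 (hE k) (c := q k) ?_).trans
      (measureReal_mono fun ω hω => ?_)
    · intro ω hω
      have hp := h.weight_pos hγ k ω
      have hω' : X k ω = 0 := hω.1.2
      rw [hω', kernel_zero_one hε hp]
      have hle := growth_mul_weight_one_le (w := fun n => θ n ω) (x := fun n => X n ω) hγ hg
        (h.weight_zero ω) (fun n => h.weight_succ n ω) k hω.1.1
      have hv : (1 + g) ^ (2 * visits (fun n => X n ω) k) ≤ (1 + g) ^ (2 * M) :=
        pow_le_pow_right₀ (by linarith) (by have : _ < M := hω.2; omega)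
      simp only [hq]
      gcongr 1 / 3 * min 1 ?_
      rw [div_le_div_iff₀ (by positivity) (hp 1), mul_assoc, mul_assoc]
      refine mul_le_mul_of_nonneg_left ?_ hε.le
      exact hle.trans (mul_le_mul_of_nonneg_left hv (hp 0).le)
    · refine ⟨fun j hj => ?_, hω.2⟩
      rcases Nat.le_succ_iff.1 hj with hj | rfl
      · exact hω.1.1.1 j hj
      · have : X (k + 1) ω = 1 := hω.2
        simp [this]
  have hD := h.sum_measureReal_survival_inter_le hε hε1 hγ (N + 1)
  have hD0 : ∑ k ∈ Finset.range N, P.real (D k) ≤ 3 :=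
    h.sum_measureReal_survival_inter_le hε hε1 hγ N
  rw [Finset.sum_range_succ'] at hD
  have hF : ∀ k, P.real (F k) ≤ 3 / M := fun k => by
    rw [le_div_iff₀ (by exact_mod_cast hM), mul_comm]
    exact h.measureReal_le_visits_le hε hε1 hγ M k
  calc P.real (survival X N) * Q = ∑ k ∈ Finset.range N, q k * P.real (survival X N) := by
        rw [hQ, mul_comm, Finset.sum_mul]
    _ ≤ ∑ k ∈ Finset.range N, (P.real (D (k + 1)) + 1 / 3 * P.real (D k) + 3 / M * q k) := by
        refine Finset.sum_le_sum fun k hk => ?_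
        have h1 := mul_le_mul_of_nonneg_left (hcover k (Finset.mem_range.1 hk).le) (hq0 k)
        have h2 := mul_le_mul_of_nonneg_right (hq1 k) (measureReal_nonneg (μ := P) (s := D k))
        have h3 := mul_le_mul_of_nonneg_left (hF k) (hq0 k)
        linarith [hjump k]
    _ = ∑ k ∈ Finset.range N, P.real (D (k + 1)) + 1 / 3 * ∑ k ∈ Finset.range N, P.real (D k) +
          3 / M * Q := by
        rw [Finset.sum_add_distrib, Finset.sum_add_distrib, hQ, Finset.mul_sum, Finset.mul_sum]
    -- Here `4 = 3 + 1/3 * 3`, since both sums of `P.real (D _)` are at most `3`.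
    _ ≤ 4 + 3 / M * Q := by
        have : 0 ≤ P.real (survival X 0 ∩ {ω | X 0 ω = 1}) := measureReal_nonneg
        have hD' : ∑ k ∈ Finset.range N, P.real (D (k + 1)) ≤ 3 := by
          simp only [D]
          linarith
        linarith

end IsProcess

end Dynamics

/-! ### Asymptotics of the growth. -/

lemma one_le_growth {γ : ℕ → ℝ} (hγ : ∀ n, 0 ≤ γ n) (k : ℕ) : 1 ≤ growth γ k := by
  simpa [growth] using growth_mono hγ (Nat.zero_le k)

lemma stepSize_nonneg {γs : ℝ} (hγs : 0 ≤ γs) (α : ℝ) (n : ℕ) : 0 ≤ stepSize γs α n := by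
  unfold stepSize
  positivity

lemma stepSize_le {γs α : ℝ} (hγs : 0 ≤ γs) (hα : 0 < α) (n : ℕ) : stepSize γs α n ≤ γs := by
  refine mul_le_of_le_one_right hγs ?_
  rcases n.eq_zero_or_pos with rfl | hn
  · simp [Real.zero_rpow (neg_ne_zero.2 hα.ne')]
  · exact Real.rpow_le_one_of_one_le_of_nonpos (by exact_mod_cast hn) (by linarith)

/-- For step sizes `γs / n`, the growth is of the order of `n ^ γs`. -/
lemma exists_growth_bounds {γs : ℝ} (hγs : 0 < γs) :
    ∃ c C : ℝ, 0 < c ∧ 0 < C ∧ ∀ n : ℕ, 0 < n →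
      c * (n : ℝ) ^ γs ≤ growth (stepSize γs 1) n ∧
      growth (stepSize γs 1) n ≤ C * (n : ℝ) ^ γs := by
  have hpos : ∀ n, 0 < growth (stepSize γs 1) n := growth_pos (stepSize_nonneg hγs.le 1)
  -- Since `growth n = ∏ (1 + γs / j)`, this is the denominator in Euler's limit formula for the
  -- Gamma function.
  have hprod : ∀ n : ℕ, ∏ j ∈ Finset.range (n + 1), (γs + j) =
      γs * (n.factorial * growth (stepSize γs 1) n) := by
    intro n
    induction n with
    | zero => simp [growth]
    | succ n ih =>
      rw [Finset.prod_range_succ, ih, growth_succ, stepSize, Real.rpow_neg_one, Nat.factorial_succ]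
      have : ((n : ℝ) + 1) ≠ 0 := by positivity
      push_cast
      field_simp
      ring
  have heq : ∀ n : ℕ, (n : ℝ) ^ γs / growth (stepSize γs 1) n = γs * Real.GammaSeq γs n := by
    intro n
    have := hpos n
    have : (0 : ℝ) < n.factorial := by positivity
    rw [Real.GammaSeq, hprod]
    field_simp
  have hlim : Tendsto (fun n : ℕ => (n : ℝ) ^ γs / growth (stepSize γs 1) n) atTop
      (𝓝 (γs * Real.Gamma γs)) := by
    simpa only [heq] using (Real.GammaSeq_tendsto_Gamma γs).const_mul γs
  have hne : γs * Real.Gamma γs ≠ 0 := (mul_pos hγs (Real.Gamma_pos_of_pos hγs)).ne'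
  obtain ⟨b, hb⟩ := hlim.bddAbove_range
  obtain ⟨C, hC⟩ := (hlim.inv₀ hne).bddAbove_range
  refine ⟨(max b 1)⁻¹, max C 1, by positivity, by positivity, fun n hn => ?_⟩
  have hn' : (0 : ℝ) < (n : ℝ) ^ γs := by positivity
  have h1 := (hb ⟨n, rfl⟩).trans (le_max_left b 1)
  have h2 := (hC ⟨n, rfl⟩).trans (le_max_left C 1)
  simp only [inv_div] at h1 h2
  rw [div_le_iff₀ (hpos n)] at h1
  rw [div_le_iff₀ hn'] at h2
  exact ⟨by rwa [inv_mul_le_iff₀ (by positivity)], h2⟩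

lemma log_growth_succ {γ : ℕ → ℝ} (hγ : ∀ n, 0 ≤ γ n) (k : ℕ) :
    Real.log (growth γ (k + 1)) = Real.log (growth γ k) + Real.log (1 + γ (k + 1)) := by
  rw [growth_succ, Real.log_mul (growth_pos hγ k).ne' (by linarith [hγ (k + 1)])]

/-- Combines `log (1 + x) ≤ x` with the concavity bound `(1 - α) * (k + 1) ^ (-α) ≤ (k + 1) ^ (1 -
α) - k ^ (1 - α)`, obtained from Bernoulli's inequality. -/
lemma log_growth_le {γs α : ℝ} (hγs : 0 ≤ γs) (hα0 : 0 ≤ α) (hα : α < 1) (k : ℕ) :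
    Real.log (growth (stepSize γs α) k) ≤ γs / (1 - α) * (k : ℝ) ^ (1 - α) := by
  have hp : 0 < 1 - α := by linarith
  have hγ := stepSize_nonneg hγs α
  induction k with
  | zero => simp [growth, Real.zero_rpow hp.ne']
  | succ k ih =>
    have hk : (0 : ℝ) < (k : ℝ) + 1 := by positivity
    have hlog := Real.log_le_sub_one_of_pos (show 0 < 1 + stepSize γs α (k + 1) by
      linarith [hγ (k + 1)])
    have hbern := rpow_one_add_le_one_add_mul_self (s := -1 / ((k : ℝ) + 1))
      (by rw [le_div_iff₀ hk]; linarith [(Nat.cast_nonneg k : (0 : ℝ) ≤ k)]) hp.le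
      (by linarith : 1 - α ≤ 1)
    have hk0 : (0 : ℝ) ≤ 1 + -1 / ((k : ℝ) + 1) := by
      have : 1 + -1 / ((k : ℝ) + 1) = k / (k + 1) := by field_simp; ring
      rw [this]
      positivity
    have hmul := mul_le_mul_of_nonneg_left hbern (Real.rpow_nonneg hk.le (1 - α))
    rw [← Real.mul_rpow hk.le hk0] at hmul
    have e1 : ((k : ℝ) + 1) * (1 + -1 / ((k : ℝ) + 1)) = k := by field_simp; ring
    have e2 : ((k : ℝ) + 1) ^ (1 - α) = ((k : ℝ) + 1) * ((k : ℝ) + 1) ^ (-α) := by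
      rw [sub_eq_add_neg, Real.rpow_add hk, Real.rpow_one]
    have e3 : ((k : ℝ) + 1) ^ (1 - α) * (1 + (1 - α) * (-1 / ((k : ℝ) + 1))) =
        ((k : ℝ) + 1) ^ (1 - α) - (1 - α) * ((k : ℝ) + 1) ^ (-α) := by
      rw [e2]
      field_simp
      ring
    rw [e1, e3] at hmul
    have hfin := mul_le_mul_of_nonneg_left hmul (show 0 ≤ γs / (1 - α) by positivity)
    have e4 : γs / (1 - α) * ((1 - α) * ((k : ℝ) + 1) ^ (-α)) = stepSize γs α (k + 1) := by
      rw [stepSize]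
      push_cast
      field_simp
    rw [mul_sub, e4] at hfin
    rw [log_growth_succ hγ]
    push_cast
    linarith

/-- Uses `log (1 + x) ≥ x / (1 + x)` with steps tending to zero. An intermediate slope `d` absorbs
the factor `1 + x`, and the gap `d - c` absorbs the contribution of the first `K` steps. -/
lemma eventually_le_log_growth {γs α c : ℝ} (hγs : 0 < γs) (hα0 : 0 < α) (hα : α < 1)
    (hc0 : 0 < c) (hc : c < γs / (1 - α)) :
    ∀ᶠ k : ℕ in atTop, c * (k : ℝ) ^ (1 - α) ≤ Real.log (growth (stepSize γs α) k) := by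
  have hp : 0 < 1 - α := by linarith
  have hγ := stepSize_nonneg hγs.le α
  obtain ⟨d, hcd, hd⟩ := exists_between hc
  have hd0 : 0 < d := hc0.trans hcd
  rw [lt_div_iff₀ hp] at hd
  have hstep : Tendsto (fun n : ℕ => 1 + stepSize γs α (n + 1)) atTop (𝓝 (1 + γs * 0)) := by
    refine Tendsto.const_add 1 (Tendsto.const_mul γs ?_)
    exact ((tendsto_rpow_neg_atTop hα0).comp tendsto_natCast_atTop_atTop).comp
      (tendsto_add_atTop_nat 1)
  have hev : ∀ᶠ n : ℕ in atTop, 1 + stepSize γs α (n + 1) < γs / (d * (1 - α)) :=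
    hstep.eventually_lt_const (by rw [lt_div_iff₀ (by positivity)]; linarith)
  obtain ⟨K, hK⟩ := eventually_atTop.1 hev
  -- The shift to `k + 1` makes the Bernoulli increment carry `(k + 1) ^ (-α)`, exactly as `γ (k +
  -- 1)` does.
  have hind : ∀ k, K ≤ k → d * (((k : ℝ) + 1) ^ (1 - α) - ((K : ℝ) + 1) ^ (1 - α)) ≤
      Real.log (growth (stepSize γs α) k) := by
    intro k hk
    induction k, hk using Nat.le_induction with
    | base => simpa using Real.log_nonneg (one_le_growth hγ K)
    | succ k hk ih =>
      have hk1 : (0 : ℝ) < (k : ℝ) + 1 := by positivity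
      have hs := hγ (k + 1)
      have hpow : (0 : ℝ) < ((k : ℝ) + 1) ^ (-α) := by positivity
      have hbern := rpow_one_add_le_one_add_mul_self (s := 1 / ((k : ℝ) + 1))
        (by have : 0 ≤ 1 / ((k : ℝ) + 1) := by positivity
            linarith) hp.le (by linarith : 1 - α ≤ 1)
      have hmul := mul_le_mul_of_nonneg_left hbern (Real.rpow_nonneg hk1.le (1 - α))
      rw [← Real.mul_rpow hk1.le (by positivity)] at hmul
      have e1 : ((k : ℝ) + 1) * (1 + 1 / ((k : ℝ) + 1)) = k + 1 + 1 := by field_simp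
      have e2 : ((k : ℝ) + 1) ^ (1 - α) = ((k : ℝ) + 1) * ((k : ℝ) + 1) ^ (-α) := by
        rw [sub_eq_add_neg, Real.rpow_add hk1, Real.rpow_one]
      have e3 : ((k : ℝ) + 1) ^ (1 - α) * (1 + (1 - α) * (1 / ((k : ℝ) + 1))) =
          ((k : ℝ) + 1) ^ (1 - α) + (1 - α) * ((k : ℝ) + 1) ^ (-α) := by
        rw [e2]
        field_simp
      rw [e1, e3] at hmul
      have hlog := Real.one_sub_inv_le_log_of_pos (show 0 < 1 + stepSize γs α (k + 1) by linarith)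
      have hlow : d * ((1 - α) * ((k : ℝ) + 1) ^ (-α)) ≤ 1 - (1 + stepSize γs α (k + 1))⁻¹ := by
        have hKk := hK k hk
        rw [lt_div_iff₀ (by positivity)] at hKk
        have e5 : 1 - (1 + stepSize γs α (k + 1))⁻¹ =
            stepSize γs α (k + 1) / (1 + stepSize γs α (k + 1)) := by
          field_simp
          ring
        have e6 : stepSize γs α (k + 1) = γs * ((k : ℝ) + 1) ^ (-α) := by
          rw [stepSize]
          push_cast
          rfl
        rw [e5, le_div_iff₀ (by linarith)]
        nth_rewrite 2 [e6]
        nlinarith [mul_le_mul_of_nonneg_right hKk.le hpow.le]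
      have hd' := mul_le_mul_of_nonneg_left hmul hd0.le
      rw [log_growth_succ hγ]
      push_cast
      linarith
  have htend : Tendsto (fun k : ℕ => (d - c) * (k : ℝ) ^ (1 - α)) atTop atTop :=
    ((tendsto_rpow_atTop hp).comp tendsto_natCast_atTop_atTop).const_mul_atTop (by linarith)
  filter_upwards [eventually_ge_atTop K, htend.eventually_ge_atTop (d * ((K : ℝ) + 1) ^ (1 - α))]
    with k hk hk2
  have h1 := hind k hk
  have h2 : (k : ℝ) ^ (1 - α) ≤ ((k : ℝ) + 1) ^ (1 - α) :=
    Real.rpow_le_rpow (by positivity) (by linarith) hp.le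
  nlinarith

/-! ### The limit `ε → 0` at deterministic times. -/

section Family

variable {Ω : ℝ → Type*} [mΩ : ∀ ε, MeasurableSpace (Ω ε)]
  {P : ∀ ε, Measure (Ω ε)} [∀ ε, IsProbabilityMeasure (P ε)]
  {ℱ : ∀ ε, Filtration ℕ (mΩ ε)} {γ : ℕ → ℝ}
  {X : ∀ ε, ℕ → Ω ε → Fin 3} {θ : ∀ ε, ℕ → Ω ε → Fin 3 → ℝ}

lemma eventually_mem_Ioo_zero_one : ∀ᶠ ε : ℝ in 𝓝[>] 0, ε ∈ Set.Ioo (0 : ℝ) 1 :=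
  Ioo_mem_nhdsGT one_pos

lemma tendsto_measureReal_compl_survival (hγ : ∀ n, 0 ≤ γ n)
    (hX : ∀ ε ∈ Set.Ioo (0 : ℝ) 1, IsProcess ε γ (P ε) (ℱ ε) (X ε) (θ ε)) (N : ℝ → ℕ)
    (hN : Tendsto (fun ε : ℝ => ε * (N ε * growth γ (N ε))) (𝓝[>] 0) (𝓝 0)) :
    Tendsto (fun ε => (P ε).real (survival (X ε) (N ε))ᶜ) (𝓝[>] 0) (𝓝 0) := by
  refine squeeze_zero' (Eventually.of_forall fun _ => measureReal_nonneg) ?_ hN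
  filter_upwards [eventually_mem_Ioo_zero_one] with ε hε
  refine ((hX ε hε).measureReal_compl_survival_le hε.1 hγ (N ε)).trans ?_
  refine mul_le_mul_of_nonneg_left ?_ hε.1.le
  have := Finset.sum_le_card_nsmul (Finset.range (N ε)) (growth γ) (growth γ (N ε))
    fun k hk => growth_mono hγ (Finset.mem_range.1 hk).le
  simpa using this

/-- The accumulated rate is bounded below by its part on `[N', N)`, where `growth` is at least
`growth γ (N' ε)`. The two divergence hypotheses cover the two values of the minimum with `1`. -/
lemma tendsto_measureReal_survival {g : ℝ} (hγ : ∀ n, 0 ≤ γ n) (hg : ∀ n, γ n ≤ g)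
    (hX : ∀ ε ∈ Set.Ioo (0 : ℝ) 1, IsProcess ε γ (P ε) (ℱ ε) (X ε) (θ ε)) (N N' : ℝ → ℕ)
    (hN : Tendsto (fun ε : ℝ => (N ε : ℝ) - N' ε) (𝓝[>] 0) atTop)
    (hN' : Tendsto (fun ε : ℝ => ((N ε : ℝ) - N' ε) * (ε * growth γ (N' ε))) (𝓝[>] 0) atTop) :
    Tendsto (fun ε => (P ε).real (survival (X ε) (N ε))) (𝓝[>] 0) (𝓝 0) := by
  have hg0 : 0 ≤ g := (hγ 0).trans (hg 0)
  refine (nhds_basis_zero_abs_lt ℝ).tendsto_right_iff.2 fun η hη => ?_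
  -- This gives `3 / m ≤ η / 2`, and `Q ≥ 16 / η` below gives `4 ≤ η / 4 * Q`, in total `3 * η / 4 <
  -- η`. As `m` does not depend on `ε`, `C` is a constant.
  obtain ⟨m, hm⟩ := exists_nat_gt (6 / η)
  have hm0 : (0 : ℝ) < m := lt_trans (by positivity) hm
  set C : ℝ := (1 + g) ^ (2 * m) with hC
  have hC0 : 0 < C := by positivity
  filter_upwards [eventually_mem_Ioo_zero_one, hN.eventually_ge_atTop 0,
    hN.eventually_ge_atTop (3 * (16 / η)), hN'.eventually_ge_atTop (3 * (16 / η) * C)]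
    with ε hε h0 h1 h2
  have hle : N' ε ≤ N ε := by
    have : (N' ε : ℝ) ≤ N ε := by linarith
    exact_mod_cast this
  have h := (hX ε hε).measureReal_survival_mul_le hε.1 hε.2.le hγ hg
    (M := m) (by exact_mod_cast hm0) (N ε) rfl
  rw [← hC] at h
  set Q := ∑ k ∈ Finset.range (N ε), 1 / 3 * min 1 (ε * growth γ k / C)
  have hε0 := hε.1
  have hQ : ((N ε : ℝ) - N' ε) * (1 / 3 * min 1 (ε * growth γ (N' ε) / C)) ≤ Q := by
    rw [← Nat.cast_sub hle, ← nsmul_eq_mul, ← Nat.card_Ico]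
    refine (Finset.card_nsmul_le_sum _ (fun k => 1 / 3 * min 1 (ε * growth γ k / C)) _ ?_).trans
      (Finset.sum_le_sum_of_subset_of_nonneg ?_ ?_)
    · intro k hk
      have := growth_mono hγ (Finset.mem_Ico.1 hk).1
      gcongr
    · intro k hk
      exact Finset.mem_range.2 (Finset.mem_Ico.1 hk).2
    · intro k _ _
      have := growth_pos hγ k
      positivity
  have hQ16 : 16 / η ≤ Q := by
    refine le_trans ?_ hQ
    rcases le_total 1 (ε * growth γ (N' ε) / C) with h3 | h3
    · rw [min_eq_left h3]
      linarith
    · rw [min_eq_right h3]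
      have := div_le_div_of_nonneg_right h2 hC0.le
      rw [mul_div_cancel_right₀ _ hC0.ne', mul_div_assoc] at this
      linarith
  have hQ0 : 0 < Q := lt_of_lt_of_le (by positivity) hQ16
  rw [abs_of_nonneg measureReal_nonneg]
  refine lt_of_mul_lt_mul_right (h.trans_lt ?_) hQ0.le
  have h4 : 4 ≤ η / 4 * Q := by
    have := mul_le_mul_of_nonneg_left hQ16 (show 0 ≤ η / 4 by positivity)
    have e : η / 4 * (16 / η) = 4 := by field_simp; norm_num
    linarith
  have h5 : 3 / (m : ℝ) ≤ η / 2 := by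
    rw [div_lt_iff₀ hη] at hm
    rw [div_le_div_iff₀ hm0 two_pos]
    linarith
  have h6 := mul_le_mul_of_nonneg_right h5 hQ0.le
  have h7 : 0 < η * Q := by positivity
  linarith

end Family

/-! ### From the exit time to survival events. -/

/-- The case `⊤` stands apart because `toNat` sends it to `0`. -/
lemma mem_survival_of_lt {Ω : Type*} {X : ℕ → Ω → Fin 3} {ω : Ω} {N : ℕ} {R : ℝ} (hN : (N : ℝ) < R)
    (h : exitTime X ω = ⊤ ∨ R ≤ (exitTime X ω).toNat) : ω ∈ survival X N := by
  rw [mem_survival_iff]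
  generalize exitTime X ω = T at h
  induction T using ENat.recTopCoe with
  | top => exact ENat.natCast_lt_top N
  | coe n =>
    have hn : R ≤ n := by simpa using h
    exact_mod_cast hN.trans_le hn

lemma notMem_survival_floor {Ω : Type*} {X : ℕ → Ω → Fin 3} {ω : Ω} {R : ℝ}
    (h : exitTime X ω ≠ ⊤) (hR : ((exitTime X ω).toNat : ℝ) ≤ R) : ω ∉ survival X ⌊R⌋₊ := by
  rw [mem_survival_iff, not_lt]
  generalize exitTime X ω = T at h hR
  induction T using ENat.recTopCoe with
  | top => exact absurd rfl h
  | coe n => exact_mod_cast Nat.le_floor (by simpa using hR)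

/-! ### Time scales of the two regimes. -/

/-- For step sizes decaying more slowly than `1 / n`, the exit time is at most of order
`σ |log ε| ^ (1 / (1 - α))` as soon as `σ > ((1 - α) / γs) ^ (1 / (1 - α))`. -/
lemma tendsto_growth_slow_upper {γs α : ℝ} (hγs : 0 < γs) (hα0 : 0 < α) (hα : α < 1) {σ σ' : ℝ}
    (hσ : ((1 - α) / γs) ^ (1 / (1 - α)) < σ) (hσ' : σ < σ') :
    Tendsto (fun ε : ℝ => (⌊σ' * |Real.log ε| ^ (1 / (1 - α))⌋₊ : ℝ) -
      ⌊σ * |Real.log ε| ^ (1 / (1 - α))⌋₊) (𝓝[>] 0) atTop ∧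
    Tendsto (fun ε : ℝ => ((⌊σ' * |Real.log ε| ^ (1 / (1 - α))⌋₊ : ℝ) -
      ⌊σ * |Real.log ε| ^ (1 / (1 - α))⌋₊) *
      (ε * growth (stepSize γs α) ⌊σ * |Real.log ε| ^ (1 / (1 - α))⌋₊)) (𝓝[>] 0) atTop := by
  have hp : 0 < 1 - α := by linarith
  have hγ := stepSize_nonneg hγs.le α
  set τ := ((1 - α) / γs) ^ (1 / (1 - α)) with hτ
  have hτ0 : 0 < τ := by positivity
  have hL : Tendsto (fun ε : ℝ => |Real.log ε|) (𝓝[>] 0) atTop :=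
    tendsto_abs_atBot_atTop.comp Real.tendsto_log_nhdsGT_zero
  have hu : Tendsto (fun ε : ℝ => |Real.log ε| ^ (1 / (1 - α))) (𝓝[>] 0) atTop :=
    (tendsto_rpow_atTop (by positivity)).comp hL
  have hfirst : Tendsto (fun ε : ℝ => (⌊σ' * |Real.log ε| ^ (1 / (1 - α))⌋₊ : ℝ) -
      ⌊σ * |Real.log ε| ^ (1 / (1 - α))⌋₊) (𝓝[>] 0) atTop := by
    refine tendsto_atTop_mono (fun ε => ?_) (tendsto_atTop_add_const_right _ (-1)
      (hu.const_mul_atTop (sub_pos.2 hσ')))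
    have hu0 : 0 ≤ |Real.log ε| ^ (1 / (1 - α)) := by positivity
    have h1 := Nat.lt_floor_add_one (σ' * |Real.log ε| ^ (1 / (1 - α)))
    have h2 := Nat.floor_le (mul_nonneg (hτ0.trans hσ).le hu0)
    linarith
  refine ⟨hfirst, tendsto_atTop_mono' _ ?_ hfirst⟩
  -- The gap `σ - ρ` absorbs the floor, and `ρ > τ` leaves room for a growth constant strictly below
  -- `γs / (1 - α)`.
  obtain ⟨ρ, hτρ, hρσ⟩ := exists_between hσ
  have hρ0 : 0 < ρ := hτ0.trans hτρ
  have hτp : τ ^ (1 - α) = (1 - α) / γs := by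
    rw [hτ, ← Real.rpow_mul (by positivity), one_div_mul_cancel hp.ne', Real.rpow_one]
  have hρp : (1 - α) / γs < ρ ^ (1 - α) := hτp ▸ Real.rpow_lt_rpow hτ0.le hτρ hp
  have hc : (ρ ^ (1 - α))⁻¹ < γs / (1 - α) := by
    rw [← inv_div]
    exact inv_strictAnti₀ (by positivity) hρp
  have hgrow := eventually_le_log_growth hγs hα0 hα (by positivity) hc
  have hfl : Tendsto (fun ε : ℝ => ⌊σ * |Real.log ε| ^ (1 / (1 - α))⌋₊) (𝓝[>] 0) atTop :=
    tendsto_nat_floor_atTop.comp (hu.const_mul_atTop (hτ0.trans hσ))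
  filter_upwards [eventually_mem_Ioo_zero_one, hfl.eventually hgrow,
    (hu.const_mul_atTop (sub_pos.2 hρσ)).eventually_ge_atTop 1, hfirst.eventually_ge_atTop 0]
    with ε hε h1 h2 h3
  refine le_mul_of_one_le_right h3 ?_
  set n := ⌊σ * |Real.log ε| ^ (1 / (1 - α))⌋₊
  have hn : ρ * |Real.log ε| ^ (1 / (1 - α)) ≤ n := by
    have := Nat.lt_floor_add_one (σ * |Real.log ε| ^ (1 / (1 - α)))
    have : σ * |Real.log ε| ^ (1 / (1 - α)) < (n : ℝ) + 1 := this
    linarith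
  have hnp := Real.rpow_le_rpow (by positivity) hn hp.le
  rw [Real.mul_rpow hρ0.le (by positivity), ← Real.rpow_mul (abs_nonneg _),
    one_div_mul_cancel hp.ne', Real.rpow_one] at hnp
  have h4 : |Real.log ε| ≤ (ρ ^ (1 - α))⁻¹ * (n : ℝ) ^ (1 - α) := by
    rw [inv_mul_eq_div, le_div_iff₀ (by positivity)]
    linarith
  have h5 : 0 ≤ Real.log (ε * growth (stepSize γs α) n) := by
    rw [Real.log_mul hε.1.ne' (growth_pos hγ n).ne']
    have := neg_abs_le (Real.log ε)
    linarith
  exact (Real.log_nonneg_iff (mul_pos hε.1 (growth_pos hγ n))).1 h5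

/-- Below the critical constant, `ε * growth` is at most `exp (-b * |log ε|)` with `b > 0`, which
beats the power of `|log ε|` coming from the number of steps. -/
lemma tendsto_growth_slow_lower {γs α : ℝ} (hγs : 0 < γs) (hα0 : 0 ≤ α) (hα : α < 1) {σ : ℝ}
    (hσ0 : 0 < σ) (hσ : σ < ((1 - α) / γs) ^ (1 / (1 - α))) :
    Tendsto (fun ε : ℝ => ε * (⌊σ * |Real.log ε| ^ (1 / (1 - α))⌋₊ *
      growth (stepSize γs α) ⌊σ * |Real.log ε| ^ (1 / (1 - α))⌋₊)) (𝓝[>] 0) (𝓝 0) := by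
  have hp : 0 < 1 - α := by linarith
  have hγ := stepSize_nonneg hγs.le α
  set τ := ((1 - α) / γs) ^ (1 / (1 - α)) with hτ
  have hτp : τ ^ (1 - α) = (1 - α) / γs := by
    rw [hτ, ← Real.rpow_mul (by positivity), one_div_mul_cancel hp.ne', Real.rpow_one]
  have hσp : σ ^ (1 - α) < (1 - α) / γs := hτp ▸ Real.rpow_lt_rpow hσ0.le hσ hp
  set b : ℝ := 1 - γs / (1 - α) * σ ^ (1 - α) with hb
  have hb0 : 0 < b := by
    have := mul_lt_mul_of_pos_left hσp (show 0 < γs / (1 - α) by positivity)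
    have e : γs / (1 - α) * ((1 - α) / γs) = 1 := by field_simp
    linarith
  have hL : Tendsto (fun ε : ℝ => |Real.log ε|) (𝓝[>] 0) atTop :=
    tendsto_abs_atBot_atTop.comp Real.tendsto_log_nhdsGT_zero
  have hlim := ((tendsto_rpow_mul_exp_neg_mul_atTop_nhds_zero (1 / (1 - α)) b hb0).comp
    hL).const_mul σ
  rw [mul_zero] at hlim
  refine squeeze_zero' ?_ ?_ hlim
  · filter_upwards [eventually_mem_Ioo_zero_one] with ε hε
    have := growth_pos hγ ⌊σ * |Real.log ε| ^ (1 / (1 - α))⌋₊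
    have := hε.1
    positivity
  · filter_upwards [eventually_mem_Ioo_zero_one] with ε hε
    have hn : (⌊σ * |Real.log ε| ^ (1 / (1 - α))⌋₊ : ℝ) ≤ σ * |Real.log ε| ^ (1 / (1 - α)) :=
      Nat.floor_le (by positivity)
    generalize ⌊σ * |Real.log ε| ^ (1 / (1 - α))⌋₊ = n at hn
    have hnp := Real.rpow_le_rpow (by positivity) hn hp.le
    rw [Real.mul_rpow hσ0.le (by positivity), ← Real.rpow_mul (abs_nonneg _),
      one_div_mul_cancel hp.ne', Real.rpow_one] at hnp
    have hlog := log_growth_le hγs.le hα0 hα n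
    have h1 := hlog.trans
      (mul_le_mul_of_nonneg_left hnp (show 0 ≤ γs / (1 - α) by positivity))
    have hεL : Real.log ε = -|Real.log ε| := by
      rw [abs_of_neg (Real.log_neg hε.1 hε.2), neg_neg]
    have h2 : ε * growth (stepSize γs α) n ≤ Real.exp (-b * |Real.log ε|) := by
      rw [← Real.log_le_iff_le_exp (mul_pos hε.1 (growth_pos hγ n)),
        Real.log_mul hε.1.ne' (growth_pos hγ n).ne', hb]
      linarith
    calc ε * (n * growth (stepSize γs α) n) = n * (ε * growth (stepSize γs α) n) := by ring
      _ ≤ σ * |Real.log ε| ^ (1 / (1 - α)) * Real.exp (-b * |Real.log ε|) := by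
        have := mul_pos hε.1 (growth_pos hγ n)
        gcongr
      _ = _ := by simp only [Function.comp_apply]; ring

lemma mul_rpow_neg_rpow {ε q x : ℝ} (hε : 0 < ε) (hq : q ≠ 0) (hx : 0 ≤ x) :
    ε * (x * ε ^ (-(1 / q))) ^ q = x ^ q := by
  rw [Real.mul_rpow hx (by positivity), ← Real.rpow_mul hε.le, neg_mul, one_div_mul_cancel hq,
    Real.rpow_neg_one]
  field_simp

lemma tendsto_growth_harmonic_lower {γs : ℝ} (hγs : 0 < γs) {h : ℝ → ℝ}
    (hh : Tendsto h (𝓝[>] 0) atTop) :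
    Tendsto (fun ε : ℝ => ε * (⌊(h ε)⁻¹ * ε ^ (-(1 / (1 + γs)))⌋₊ *
      growth (stepSize γs 1) ⌊(h ε)⁻¹ * ε ^ (-(1 / (1 + γs)))⌋₊)) (𝓝[>] 0) (𝓝 0) := by
  have hγ := stepSize_nonneg hγs.le 1
  obtain ⟨c, C, -, hC, hcC⟩ := exists_growth_bounds hγs
  have hlim : Tendsto (fun ε => C * (h ε)⁻¹ ^ (1 + γs)) (𝓝[>] 0) (𝓝 0) := by
    have := ((hh.inv_tendsto_atTop).rpow_const (p := 1 + γs) (Or.inr (by linarith))).const_mul C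
    simpa [Real.zero_rpow (by linarith : 1 + γs ≠ 0)] using this
  refine squeeze_zero' ?_ ?_ hlim
  · filter_upwards [eventually_mem_Ioo_zero_one] with ε hε
    have := growth_pos hγ ⌊(h ε)⁻¹ * ε ^ (-(1 / (1 + γs)))⌋₊
    have := hε.1
    positivity
  · filter_upwards [eventually_mem_Ioo_zero_one, hh.eventually_gt_atTop 0] with ε hε hpos
    have hε0 := hε.1
    have hn : (⌊(h ε)⁻¹ * ε ^ (-(1 / (1 + γs)))⌋₊ : ℝ) ≤ (h ε)⁻¹ * ε ^ (-(1 / (1 + γs))) :=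
      Nat.floor_le (by positivity)
    generalize ⌊(h ε)⁻¹ * ε ^ (-(1 / (1 + γs)))⌋₊ = n at hn
    -- At `n = 0` the bound `C * n ^ γs` vanishes while `growth` is `1`; the factor `n` settles this
    -- case.
    rcases n.eq_zero_or_pos with rfl | hn0
    · simp only [Nat.cast_zero, zero_mul, mul_zero]
      positivity
    · have hn' : (0 : ℝ) < n := by exact_mod_cast hn0
      calc ε * (n * growth (stepSize γs 1) n) ≤ ε * (n * (C * (n : ℝ) ^ γs)) := by
            gcongr
            exact (hcC n hn0).2
        _ = C * (ε * (n : ℝ) ^ (1 + γs)) := by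
            rw [Real.rpow_add hn', Real.rpow_one]
            ring
        _ ≤ C * (ε * ((h ε)⁻¹ * ε ^ (-(1 / (1 + γs)))) ^ (1 + γs)) := by gcongr
        _ = _ := by rw [mul_rpow_neg_rpow hε0 (by linarith) (by positivity)]

lemma tendsto_growth_harmonic_upper {γs : ℝ} (hγs : 0 < γs) {h : ℝ → ℝ}
    (hh : Tendsto h (𝓝[>] 0) atTop) :
    Tendsto (fun ε : ℝ => (⌊h ε / 2 * ε ^ (-(1 / (1 + γs)))⌋₊ : ℝ) -
      ⌊h ε / 4 * ε ^ (-(1 / (1 + γs)))⌋₊) (𝓝[>] 0) atTop ∧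
    Tendsto (fun ε : ℝ => ((⌊h ε / 2 * ε ^ (-(1 / (1 + γs)))⌋₊ : ℝ) -
      ⌊h ε / 4 * ε ^ (-(1 / (1 + γs)))⌋₊) *
      (ε * growth (stepSize γs 1) ⌊h ε / 4 * ε ^ (-(1 / (1 + γs)))⌋₊)) (𝓝[>] 0) atTop := by
  have hq : 0 < 1 + γs := by linarith
  have hγ := stepSize_nonneg hγs.le 1
  obtain ⟨c, C, hc, -, hcC⟩ := exists_growth_bounds hγs
  have hr : Tendsto (fun ε : ℝ => ε ^ (-(1 / (1 + γs)))) (𝓝[>] 0) atTop :=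
    tendsto_rpow_neg_nhdsGT_zero (by simp; positivity)
  have hR : Tendsto (fun ε : ℝ => h ε / 8 * ε ^ (-(1 / (1 + γs)))) (𝓝[>] 0) atTop :=
    (hh.atTop_div_const (by norm_num)).atTop_mul_atTop₀ hr
  -- With `R` the left-hand side, the floors are those of `4 * R` and `2 * R`, and rounding loses at
  -- most `1 ≤ R`.
  have hev : ∀ᶠ ε : ℝ in 𝓝[>] 0,
      h ε / 8 * ε ^ (-(1 / (1 + γs))) ≤ (⌊h ε / 2 * ε ^ (-(1 / (1 + γs)))⌋₊ : ℝ) -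
        ⌊h ε / 4 * ε ^ (-(1 / (1 + γs)))⌋₊ ∧
      h ε / 8 * ε ^ (-(1 / (1 + γs))) ≤ ⌊h ε / 4 * ε ^ (-(1 / (1 + γs)))⌋₊ := by
    filter_upwards [hR.eventually_ge_atTop 1] with ε h1
    have h2 := Nat.lt_floor_add_one (h ε / 2 * ε ^ (-(1 / (1 + γs))))
    have h3 := Nat.lt_floor_add_one (h ε / 4 * ε ^ (-(1 / (1 + γs))))
    have h4 := Nat.floor_le (show 0 ≤ h ε / 4 * ε ^ (-(1 / (1 + γs))) by linarith)
    constructor <;> linarith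
  refine ⟨tendsto_atTop_mono' _ (hev.mono fun ε hε => hε.1) hR, ?_⟩
  have hlim : Tendsto (fun ε => c * (h ε / 8) ^ (1 + γs)) (𝓝[>] 0) atTop :=
    ((tendsto_rpow_atTop hq).comp (hh.atTop_div_const (by norm_num))).const_mul_atTop hc
  refine tendsto_atTop_mono' _ ?_ hlim
  filter_upwards [hev, hR.eventually_ge_atTop 1, eventually_mem_Ioo_zero_one,
    hh.eventually_gt_atTop 0] with ε hε h1 hε1 hpos
  obtain ⟨h2, h3⟩ := hε
  have hε0 := hε1.1
  set R := h ε / 8 * ε ^ (-(1 / (1 + γs))) with hRdef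
  have hR0 : 0 < R := by linarith
  set n := ⌊h ε / 4 * ε ^ (-(1 / (1 + γs)))⌋₊
  have hn0 : 0 < n := by
    have : (0 : ℝ) < n := by linarith
    exact_mod_cast this
  calc c * (h ε / 8) ^ (1 + γs) = c * (ε * R ^ (1 + γs)) := by
        rw [hRdef, mul_rpow_neg_rpow hε0 hq.ne' (by positivity)]
    _ = R * (ε * (c * R ^ γs)) := by
        rw [Real.rpow_add hR0, Real.rpow_one]
        ring
    _ ≤ R * (ε * (c * (n : ℝ) ^ γs)) := by gcongr
    _ ≤ R * (ε * growth (stepSize γs 1) n) := by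
        gcongr
        exact (hcC n hn0).1
    _ ≤ _ := by
        have := growth_pos hγ n
        gcongr

end WangLandau

/-! ### The two limit statements. -/

theorem mainTheorem1 (γs α : ℝ) (hγs : 0 < γs) (hα : α ∈ Set.Icc (1 / 2 : ℝ) 1)
    (hγα : α = 1 / 2 → γs < 1)
    {Ω : ℝ → Type*} [mΩ : ∀ ε, MeasurableSpace (Ω ε)]
    (P : ∀ ε, Measure (Ω ε)) [∀ ε, IsProbabilityMeasure (P ε)]
    (ℱ : ∀ ε, Filtration ℕ (mΩ ε))
    (X : ∀ ε, ℕ → Ω ε → Fin 3) (θ : ∀ ε, ℕ → Ω ε → Fin 3 → ℝ)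
    (hX : ∀ ε ∈ Set.Ioo (0 : ℝ) 1,
      WangLandau.IsProcess ε (WangLandau.stepSize γs α) (P ε) (ℱ ε) (X ε) (θ ε)) :
    (α < 1 → ∀ δ : ℝ, 0 < δ →
      Tendsto
        (fun ε : ℝ => P ε {ω | WangLandau.exitTime (X ε) ω = ⊤ ∨
          δ ≤ |(|Real.log ε| ^ (-1 / (1 - α)) * (WangLandau.exitTime (X ε) ω).toNat
            - ((1 - α) / γs) ^ (1 / (1 - α)))|})
        (𝓝[>] 0) (𝓝 0)) ∧
    (α = 1 → ∀ h : ℝ → ℝ, Tendsto h (𝓝[>] 0) atTop →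
      Tendsto
        (fun ε : ℝ => P ε {ω | WangLandau.exitTime (X ε) ω ≠ ⊤ ∧
          1 / h ε < ε ^ (1 / (1 + γs)) * (WangLandau.exitTime (X ε) ω).toNat ∧
          ε ^ (1 / (1 + γs)) * (WangLandau.exitTime (X ε) ω).toNat < h ε})
        (𝓝[>] 0) (𝓝 1)) := by
  have hα0 : 0 < α := by linarith [hα.1]
  have hγ := WangLandau.stepSize_nonneg hγs.le α
  have hg := WangLandau.stepSize_le hγs.le hα0
  constructor
  · intro hα1 δ hδ
    have hp : 0 < 1 - α := by linarith
    set τ := ((1 - α) / γs) ^ (1 / (1 - α)) with hτ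
    have hτ0 : 0 < τ := by positivity
    -- `ρ < τ` keeps the lower threshold `τ - ρ` positive, and `ρ < δ` places survival up to `(τ +
    -- ρ) * u` strictly inside the deviation `δ`.
    obtain ⟨ρ, hρ0, hρ⟩ := exists_between (lt_min hδ hτ0)
    obtain ⟨hρδ, hρτ⟩ := lt_min_iff.1 hρ
    obtain ⟨hu1, hu2⟩ := WangLandau.tendsto_growth_slow_upper hγs hα0 hα1 (σ := τ + ρ / 2)
      (σ' := τ + ρ) (by linarith) (by linarith)
    have hup := WangLandau.tendsto_measureReal_survival hγ hg hX _ _ hu1 hu2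
    have hlow := WangLandau.tendsto_measureReal_compl_survival hγ hX _
      (WangLandau.tendsto_growth_slow_lower hγs hα0.le hα1 (σ := τ - ρ) (by linarith)
        (by linarith))
    have hsum := ENNReal.tendsto_ofReal (hup.add hlow)
    rw [add_zero, ENNReal.ofReal_zero] at hsum
    refine tendsto_of_tendsto_of_tendsto_of_le_of_le' tendsto_const_nhds hsum
      (Eventually.of_forall fun _ => zero_le) ?_
    filter_upwards [WangLandau.eventually_mem_Ioo_zero_one] with ε hε
    rw [← ofReal_measureReal]
    refine ENNReal.ofReal_le_ofReal (le_trans (measureReal_mono ?_) (measureReal_union_le _ _))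
    intro ω hω
    have hL : 0 < |Real.log ε| := abs_pos.2 (Real.log_neg hε.1 hε.2).ne
    set u := |Real.log ε| ^ (1 / (1 - α)) with hu
    have hu0 : 0 < u := by positivity
    have hinv : |Real.log ε| ^ (-1 / (1 - α)) = u⁻¹ := by rw [hu, neg_div, Real.rpow_neg hL.le]
    have hfl : (⌊(τ + ρ) * u⌋₊ : ℝ) < (τ + δ) * u :=
      (Nat.floor_le (by positivity)).trans_lt (by gcongr)
    by_cases htop : WangLandau.exitTime (X ε) ω = ⊤
    · exact Or.inl (WangLandau.mem_survival_of_lt hfl (Or.inl htop))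
    · have habs : δ ≤ |u⁻¹ * (WangLandau.exitTime (X ε) ω).toNat - τ| := by
        rw [← hinv]
        exact hω.resolve_left htop
      rcases le_abs'.1 habs with h | h
      · refine Or.inr (WangLandau.notMem_survival_floor htop ?_)
        have h' : u⁻¹ * ((WangLandau.exitTime (X ε) ω).toNat : ℝ) ≤ τ - ρ := by linarith
        rw [inv_mul_le_iff₀ hu0] at h'
        linarith
      · refine Or.inl (WangLandau.mem_survival_of_lt hfl (Or.inr ?_))
        have h' : τ + δ ≤ u⁻¹ * ((WangLandau.exitTime (X ε) ω).toNat : ℝ) := by linarith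
        rw [le_inv_mul_iff₀ hu0] at h'
        linarith
  · rintro rfl h hh
    obtain ⟨hu1, hu2⟩ := WangLandau.tendsto_growth_harmonic_upper hγs hh
    have hup := WangLandau.tendsto_measureReal_survival hγ hg hX _ _ hu1 hu2
    have hlow := WangLandau.tendsto_measureReal_compl_survival hγ hX _
      (WangLandau.tendsto_growth_harmonic_lower hγs hh)
    have hsum := ENNReal.tendsto_ofReal ((hup.add hlow).const_sub 1)
    rw [add_zero, sub_zero, ENNReal.ofReal_one] at hsum
    refine tendsto_of_tendsto_of_tendsto_of_le_of_le' hsum tendsto_const_nhds ?_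
      (Eventually.of_forall fun _ => prob_le_one)
    filter_upwards [WangLandau.eventually_mem_Ioo_zero_one, hh.eventually_gt_atTop 0]
      with ε hε hpos
    rw [← ofReal_measureReal]
    refine ENNReal.ofReal_le_ofReal ?_
    have hr0 : 0 < ε ^ (1 / (1 + γs)) := Real.rpow_pos_of_pos hε.1 _
    have hneg : ε ^ (-(1 / (1 + γs))) = (ε ^ (1 / (1 + γs)))⁻¹ := Real.rpow_neg hε.1.le _
    rw [hneg]
    set r := ε ^ (1 / (1 + γs))
    set A := WangLandau.survival (X ε) ⌊h ε / 2 * r⁻¹⌋₊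
    set B := (WangLandau.survival (X ε) ⌊(h ε)⁻¹ * r⁻¹⌋₊)ᶜ
    set E := {ω | WangLandau.exitTime (X ε) ω ≠ ⊤ ∧
      1 / h ε < r * (WangLandau.exitTime (X ε) ω).toNat ∧
      r * (WangLandau.exitTime (X ε) ω).toNat < h ε}
    -- `A` is a late or absent exit and `B` an early one. The factor `h ε / 2` makes the upper
    -- inequality strict.
    have hcover : Set.univ ⊆ E ∪ (A ∪ B) := by
      intro ω _
      by_contra hcon
      simp only [Set.mem_union, not_or] at hcon
      obtain ⟨hE, hA, hB⟩ := hcon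
      have hfl : (⌊h ε / 2 * r⁻¹⌋₊ : ℝ) < h ε * r⁻¹ :=
        (Nat.floor_le (by positivity)).trans_lt (by gcongr; linarith)
      have hA' := mt (WangLandau.mem_survival_of_lt (X := X ε) (ω := ω) hfl) hA
      rw [not_or, not_le] at hA'
      refine hE ⟨hA'.1, ?_, ?_⟩
      · by_contra hle
        refine hB (WangLandau.notMem_survival_floor hA'.1 ?_)
        rw [not_lt, one_div, mul_comm, ← le_div_iff₀ hr0, div_eq_mul_inv] at hle
        exact hle
      · rw [mul_comm, ← lt_div_iff₀ hr0, div_eq_mul_inv]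
        exact hA'.2
    have h1 : (P ε).real Set.univ ≤ (P ε).real E + ((P ε).real A + (P ε).real B) :=
      (measureReal_mono hcover).trans ((measureReal_union_le _ _).trans
        (by gcongr; exact measureReal_union_le _ _))
    rw [probReal_univ] at h1
    linarith
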